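/- All algebras are over $\mathbb{C}$, associative, not necessarily unital, with non-degenerate product ($ab=0$ for all $b$ implies $a=0$, and $ab=0$ for all $a$ implies $b=0$). The multiplier algebra $M(A)$ is the unital algebra of compatible pairs of a left and a right multiplier of $A$: a multiplier $m$ consists of linear maps $a\mapsto ma$ and $a\mapsto am$ of $A$ with $m(ab)=(ma)b$, $(ab)m=a(bm)$, $(am)b=a(mb)$. We have $A\subseteq M(A)$ and $A\otimes A\subseteq A\otimes M(A)\subseteq M(A\otimes A)$. A multiplier Hopf algebra is such an algebra $A$ with a homomorphism $\Delta:A\to M(A\otimes A)$ such that $\Delta(a)(1\otimes b)$ and $(a\otimes 1)\Delta(b)$ lie in $A\otimes A$ for all $a,b\in A$, such that $(a\otimes 1\otimes 1)(\Delta\otimes\iota)(\Delta(b)(1\otimes c))=(\iota\otimes\Delta)((a\otimes 1)\Delta(b))(1\otimes 1\otimes c)$ for all $a,b,c\in A$, and such that the linear maps $a\otimes b\mapsto\Delta(a)(1\otimes b)$ and $a\otimes b\mapsto(a\otimes 1)\Delta(b)$ are bijections of $A\otimes A$. It is regular if $(A,\Delta^{cop})$ is a multiplier Hopf algebra too, where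 $\Delta^{cop}$ is $\Delta$ followed by the flip of the two tensor factors. Its counit is the linear map $\varepsilon:A\to\mathbb{C}$ determined by $(\varepsilon\otimes\iota)(\Delta(a)(1\otimes b))=ab=(\iota\otimes\varepsilon)((a\otimes 1)\Delta(b))$. In the regular case its antipode is the linear map $S:A\to A$ determined by $m(S\otimes\iota)(\Delta(a)(1\otimes b))=\varepsilon(a)b$ and $m(\iota\otimes S)((a\otimes 1)\Delta(b))=\varepsilon(b)a$, where $m$ is the product; it is an anti-automorphism of $A$ and is extended to $M(A)$ by $S(x)S(a)=S(ax)$, $S(a)S(x)=S(xa)$ for $x\in M(A)$, $a\in A$. **Lemma 2.2.** Let $(A,\Delta)$ be a regular multiplier Hopf algebra with antipode $S$. Let $R\in M(A\otimes A)$ be such that $R(a\otimes 1)$ and $(a\otimes 1)R$ lie in $A\otimes M(A)$ for all $a\in A$, and such that $R\Delta(a)=\Delta^{cop}(a)R$ in $M(A\otimes A)$ for all $a\in A$. Define the left multiplier $u$ of $A$ by $ua=\sum_i S(m_i)x_i\in A$, where $R(a\otimes 1)=\sum_i x_i\otimes m_i$ with $x_i\in A$, $m_i\in M(A)$ (that is,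 $ua=\sum S(R^{(2)})R^{(1)}a$). Then: (1) $u$ is a (two-sided) multiplier, $u\in M(A)$, and $ua=S^2(a)u$ for all $a\in A$. (2) If $R$ is invertible in $M(A\otimes A)$, then $u$ and $S(u)$ are invertible in $M(A)$, and for all $a\in A$ $$S^2(a)=uau^{-1}=S(u)^{-1}aS(u).$$ In particular $S^2$ is an inner automorphism. -/

import Mathlib

open scoped TensorProduct

section Multipliers

variable (A : Type*) [NonUnitalRing A] [Module ℂ A] [SMulCommClass ℂ A A] [IsScalarTower ℂ A A]

/-- The multiplier algebra `M(A)`, realised as an algebra of pairs `(L, op R)` of linear maps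
`A → A`: `L` is a left multiplier (`a ↦ m a`), `R` is a right multiplier (`a ↦ a m`), and they are
compatible, `(a m) b = a (m b)`. The product is `(m n) a = m (n a)`, `a (m n) = (a m) n`. -/
def MultiplierAlgebra :
    Subalgebra ℂ (Module.End ℂ A × (Module.End ℂ A)ᵐᵒᵖ) where
  carrier := {p | (∀ a b, p.1 (a * b) = p.1 a * b) ∧
    (∀ a b, p.2.unop (a * b) = a * p.2.unop b) ∧ ∀ a b, p.2.unop a * b = a * p.1 b}
  mul_mem' := by
    rintro p q ⟨h1, h2, h3⟩ ⟨k1, k2, k3⟩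
    refine ⟨fun a b => ?_, fun a b => ?_, fun a b => ?_⟩
    · simp [k1, h1]
    · simp [k2, h2]
    · simp [k3, h3]
  add_mem' := by
    rintro p q ⟨h1, h2, h3⟩ ⟨k1, k2, k3⟩
    refine ⟨fun a b => ?_, fun a b => ?_, fun a b => ?_⟩
    · simp [k1, h1, add_mul]
    · simp [k2, h2, mul_add]
    · simp [k3, h3, mul_add, add_mul]
  algebraMap_mem' := by
    intro c
    refine ⟨fun a b => ?_, fun a b => ?_, fun a b => ?_⟩ <;>
      simp [Algebra.algebraMap_eq_smul_one, smul_mul_assoc, mul_smul_comm]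

/-- The type of elements of `M(A)`. -/
def Multiplier : Type _ := MultiplierAlgebra A

instance : Ring (Multiplier A) := inferInstanceAs (Ring (MultiplierAlgebra A))

instance : Algebra ℂ (Multiplier A) := inferInstanceAs (Algebra ℂ (MultiplierAlgebra A))

end Multipliers

namespace Multiplier

set_option linter.unusedSectionVars false

variable {A : Type*} [NonUnitalRing A] [Module ℂ A] [SMulCommClass ℂ A A] [IsScalarTower ℂ A A]

/-- Left multiplication by a multiplier, `a ↦ m a`. -/
def left : Multiplier A →ₗ[ℂ] A →ₗ[ℂ] A where
  toFun m := m.1.1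
  map_add' _ _ := rfl
  map_smul' _ _ := rfl

/-- Right multiplication by a multiplier, `a ↦ a m`. -/
def right : Multiplier A →ₗ[ℂ] A →ₗ[ℂ] A where
  toFun m := m.1.2.unop
  map_add' _ _ := rfl
  map_smul' _ _ := rfl

theorem left_mul' (m : Multiplier A) (a b : A) : left m (a * b) = left m a * b := m.2.1 a b

theorem right_mul' (m : Multiplier A) (a b : A) : right m (a * b) = a * right m b := m.2.2.1 a b

theorem right_mul_eq (m : Multiplier A) (a b : A) : right m a * b = a * left m b := m.2.2.2 a b

/-- Build a multiplier from a compatible pair. -/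
def mk (L R : A →ₗ[ℂ] A) (hL : ∀ a b, L (a * b) = L a * b) (hR : ∀ a b, R (a * b) = a * R b)
    (h : ∀ a b, R a * b = a * L b) : Multiplier A :=
  ⟨(L, MulOpposite.op R), hL, hR, h⟩

theorem left_mk (L R : A →ₗ[ℂ] A) (hL hR h) : left (mk L R hL hR h) = L := rfl

theorem right_mk (L R : A →ₗ[ℂ] A) (hL hR h) : right (mk L R hL hR h) = R := rfl

theorem ext_iff' {m n : Multiplier A} : m = n ↔ left m = left n ∧ right m = right n := by
  constructor
  · rintro rfl; exact ⟨rfl, rfl⟩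
  · rintro ⟨h1, h2⟩
    exact Subtype.ext (Prod.ext h1 (MulOpposite.unop_injective h2))

/-- The canonical map `A → M(A)`. -/
def of : A →ₗ[ℂ] Multiplier A where
  toFun a := mk (LinearMap.mulLeft ℂ a) (LinearMap.mulRight ℂ a)
    (fun x y => by simp [mul_assoc]) (fun x y => by simp [mul_assoc])
    (fun x y => by simp [mul_assoc])
  map_add' a b := ext_iff'.2
    ⟨LinearMap.ext fun x => add_mul a b x, LinearMap.ext fun x => mul_add x a b⟩
  map_smul' c a := ext_iff'.2
    ⟨LinearMap.ext fun x => smul_mul_assoc c a x, LinearMap.ext fun x => mul_smul_comm c x a⟩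

theorem left_of (a b : A) : left (of a) b = a * b := rfl

theorem right_of (a b : A) : right (of a) b = b * a := rfl

theorem left_mul_apply (m n : Multiplier A) (a : A) : left (m * n) a = left m (left n a) := rfl

theorem right_mul_apply (m n : Multiplier A) (a : A) : right (m * n) a = right n (right m a) := rfl

theorem left_one (a : A) : left 1 a = a := rfl

theorem right_one (a : A) : right 1 a = a := rfl

/-- For multipliers `m`, `n` of `A`, the multiplier `m ⊗ n` of `A ⊗ A`. -/
def tmul (m n : Multiplier A) : Multiplier (A ⊗[ℂ] A) :=
  mk (TensorProduct.map (left m) (left n)) (TensorProduct.map (right m) (right n))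
    (fun x y => by
      induction x with
      | zero => simp
      | add x x' hx hx' => simp only [add_mul, map_add, hx, hx']
      | tmul a b =>
        induction y with
        | zero => simp
        | add y y' hy hy' => simp only [mul_add, map_add, hy, hy']
        | tmul c d => simp [left_mul'])
    (fun x y => by
      induction x with
      | zero => simp
      | add x x' hx hx' => simp only [add_mul, map_add, hx, hx']
      | tmul a b =>
        induction y with
        | zero => simp
        | add y y' hy hy' => simp only [mul_add, map_add, hy, hy']
        | tmul c d => simp [right_mul'])
    (fun x y => by
      induction x with
      | zero => simp
      | add x x' hx hx' => simp only [add_mul, map_add, hx, hx']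
      | tmul a b =>
        induction y with
        | zero => simp
        | add y y' hy hy' => simp only [mul_add, map_add, hy, hy']
        | tmul c d => simp [right_mul_eq])

theorem comm_mul' (x y : A ⊗[ℂ] A) :
    TensorProduct.comm ℂ A A (x * y) = TensorProduct.comm ℂ A A x * TensorProduct.comm ℂ A A y := by
  induction x with
  | zero => simp
  | add x x' hx hx' => simp only [add_mul, map_add, hx, hx']
  | tmul a b =>
    induction y with
    | zero => simp
    | add y y' hy hy' => simp only [mul_add, map_add, hy, hy']
    | tmul c d => simp

/-- The extension to `M(A ⊗ A)` of the flip `a ⊗ b ↦ b ⊗ a`. -/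
def flip (m : Multiplier (A ⊗[ℂ] A)) : Multiplier (A ⊗[ℂ] A) :=
  mk ((TensorProduct.comm ℂ A A).toLinearMap ∘ₗ left m ∘ₗ (TensorProduct.comm ℂ A A).toLinearMap)
    ((TensorProduct.comm ℂ A A).toLinearMap ∘ₗ right m ∘ₗ (TensorProduct.comm ℂ A A).toLinearMap)
    (fun x y => by simp [comm_mul', left_mul'])
    (fun x y => by simp [comm_mul', right_mul'])
    (fun x y => by
      apply (TensorProduct.comm ℂ A A).injective
      simp [comm_mul', right_mul_eq])

/-- The canonical map `A ⊗ M(A) → M(A ⊗ A)`, `a ⊗ m ↦ a ⊗ m`. It is injective when the product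
of `A` is non-degenerate (`ofTensor_injective`), and its range is the subspace `A ⊗ M(A)` of
`M(A ⊗ A)`. -/
def ofTensor : A ⊗[ℂ] Multiplier A →ₗ[ℂ] Multiplier (A ⊗[ℂ] A) :=
  TensorProduct.lift (LinearMap.mk₂ ℂ (fun a m => tmul (of a) m)
    (fun a b m => ext_iff'.2 ⟨by simp [tmul, left_mk, TensorProduct.map_add_left],
      by simp [tmul, right_mk, TensorProduct.map_add_left]⟩)
    (fun c a m => ext_iff'.2 ⟨by simp [tmul, left_mk, TensorProduct.map_smul_left],
      by simp [tmul, right_mk, TensorProduct.map_smul_left]⟩)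
    (fun a m n => ext_iff'.2 ⟨by simp [tmul, left_mk, TensorProduct.map_add_right],
      by simp [tmul, right_mk, TensorProduct.map_add_right]⟩)
    (fun c a m => ext_iff'.2 ⟨by simp [tmul, left_mk, TensorProduct.map_smul_right],
      by simp [tmul, right_mk, TensorProduct.map_smul_right]⟩))

end Multiplier

open Multiplier in
/-- A multiplier Hopf algebra structure (Van Daele) on the complex algebra `A`, which need not have
a unit: the product is non-degenerate, `Δ : A → M(A ⊗ A)` is a homomorphism, the elements
`Δ(a)(1 ⊗ b)` and `(a ⊗ 1)Δ(b)` of `M(A ⊗ A)` lie in `A ⊗ A`, `Δ` is coassociative, and the linear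
maps `T₁ : a ⊗ b ↦ Δ(a)(1 ⊗ b)` and `T₂ : a ⊗ b ↦ (a ⊗ 1)Δ(b)` are bijections of `A ⊗ A`.
(`T₁` and `T₂` are determined by `Δ`, since `A ⊗ A → M(A ⊗ A)` is injective.) -/
structure MultiplierHopfAlgebra (A : Type*) [NonUnitalRing A] [Module ℂ A] [SMulCommClass ℂ A A]
    [IsScalarTower ℂ A A] where
  eq_zero_of_forall_mul_eq_zero : ∀ a : A, (∀ b, a * b = 0) → a = 0
  eq_zero_of_forall_mul_eq_zero' : ∀ a : A, (∀ b, b * a = 0) → a = 0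
  /-- the comultiplication -/
  Δ : A →ₙₐ[ℂ] Multiplier (A ⊗[ℂ] A)
  /-- the bijection `a ⊗ b ↦ Δ(a)(1 ⊗ b)` -/
  T₁ : A ⊗[ℂ] A ≃ₗ[ℂ] A ⊗[ℂ] A
  of_T₁ : ∀ a b, of (T₁ (a ⊗ₜ b)) = Δ a * tmul 1 (of b)
  /-- the bijection `a ⊗ b ↦ (a ⊗ 1)Δ(b)` -/
  T₂ : A ⊗[ℂ] A ≃ₗ[ℂ] A ⊗[ℂ] A
  of_T₂ : ∀ a b, of (T₂ (a ⊗ₜ b)) = tmul (of a) 1 * Δ b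
  /-- `(a ⊗ 1 ⊗ 1) (Δ ⊗ ι)(Δ(b)(1 ⊗ c)) = (ι ⊗ Δ)((a ⊗ 1)Δ(b)) (1 ⊗ 1 ⊗ c)` -/
  coassoc : ∀ a b c : A,
    T₂.toLinearMap.rTensor A ((TensorProduct.assoc ℂ A A A).symm (a ⊗ₜ T₁ (b ⊗ₜ c))) =
      (TensorProduct.assoc ℂ A A A).symm
        (T₁.toLinearMap.lTensor A (TensorProduct.assoc ℂ A A A (T₂ (a ⊗ₜ b) ⊗ₜ c)))

/-- A multiplier Hopf algebra `(A, Δ)` is regular if `(A, Δ^cop)` is a multiplier Hopf algebra too,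
where `Δ^cop` is `Δ` followed by the flip. -/
structure RegularMultiplierHopfAlgebra (A : Type*) [NonUnitalRing A] [Module ℂ A]
    [SMulCommClass ℂ A A] [IsScalarTower ℂ A A] extends MultiplierHopfAlgebra A where
  regular : ∃ H : MultiplierHopfAlgebra A, ∀ a, H.Δ a = (Δ a).flip

namespace Multiplier

variable {A : Type*} [NonUnitalRing A] [Module ℂ A] [SMulCommClass ℂ A A] [IsScalarTower ℂ A A]

theorem ofTensor_injective (h : ∀ a : A, (∀ b, a * b = 0) → a = 0) :
    Function.Injective (ofTensor : A ⊗[ℂ] Multiplier A →ₗ[ℂ] Multiplier (A ⊗[ℂ] A)) := by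
  rw [injective_iff_map_eq_zero]
  intro x hx
  have key (φ : A →ₗ[ℂ] ℂ) (q : A) (y : A ⊗[ℂ] Multiplier A) (p : A) :
      TensorProduct.rid ℂ A (φ.lTensor A (left (ofTensor y) (p ⊗ₜ q))) =
        TensorProduct.rid ℂ A ((φ ∘ₗ left.flip q).lTensor A y) * p := by
    induction y with
    | zero => simp
    | add y y' hy hy' => simp only [map_add, LinearMap.add_apply, add_mul, hy, hy']
    | tmul a m => simp [ofTensor, tmul, left_mk, left_of, smul_mul_assoc]
  have hF (φ : A →ₗ[ℂ] ℂ) (q : A) :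
      TensorProduct.rid ℂ A ((φ ∘ₗ left.flip q).lTensor A x) = 0 :=
    h _ fun p => by rw [← key, hx]; simp
  have swap (φ ψ : A →ₗ[ℂ] ℂ) (q : A) (y : A ⊗[ℂ] Multiplier A) :
      φ (left (TensorProduct.lid ℂ _ (ψ.rTensor _ y)) q) =
        ψ (TensorProduct.rid ℂ A ((φ ∘ₗ left.flip q).lTensor A y)) := by
    induction y with
    | zero => simp
    | add y y' hy hy' => simp only [map_add, LinearMap.add_apply, hy, hy']
    | tmul a m => simp [mul_comm]
  have hs (ψ : A →ₗ[ℂ] ℂ) : TensorProduct.lid ℂ _ (ψ.rTensor _ x) = (0 : Multiplier A) := by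
    have h0 : left (TensorProduct.lid ℂ _ (ψ.rTensor _ x)) = 0 := by
      ext q
      refine (Module.forall_dual_apply_eq_zero_iff ℂ _).1 fun φ => ?_
      rw [swap, hF, map_zero]
    refine ext_iff'.2 ⟨by rw [h0, map_zero], ?_⟩
    ext a
    refine h _ fun b => ?_
    rw [right_mul_eq, h0]
    simp
  let B := Module.Free.chooseBasis ℂ A
  apply (TensorProduct.equivFinsuppOfBasisLeft B).injective
  ext1 i
  rw [TensorProduct.equivFinsuppOfBasisLeft_apply, hs]
  simp

end Multiplier

namespace RegularMultiplierHopfAlgebra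

open Multiplier

variable {A : Type*} [NonUnitalRing A] [Module ℂ A] [SMulCommClass ℂ A A] [IsScalarTower ℂ A A]
  (H : RegularMultiplierHopfAlgebra A)

/-- The comultiplication followed by the flip, `Δ^cop`. -/
def Δcop (a : A) : Multiplier (A ⊗[ℂ] A) := (H.Δ a).flip

/-- The equations `(ε ⊗ ι)(Δ(a)(1 ⊗ b)) = ab` and `(ι ⊗ ε)((a ⊗ 1)Δ(b)) = ab`. -/
def IsCounit (ε : A →ₗ[ℂ] ℂ) : Prop :=
  ∀ a b : A, TensorProduct.lid ℂ A (ε.rTensor A (H.T₁ (a ⊗ₜ b))) = a * b ∧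
    TensorProduct.rid ℂ A (ε.lTensor A (H.T₂ (a ⊗ₜ b))) = a * b

/-- The counit: the unique linear functional with `IsCounit`. -/
noncomputable def counit : A →ₗ[ℂ] ℂ := Classical.epsilon H.IsCounit

/-- The equations `m(S ⊗ ι)(Δ(a)(1 ⊗ b)) = ε(a)b` and `m(ι ⊗ S)((a ⊗ 1)Δ(b)) = ε(b)a`. -/
def IsAntipode (S : A →ₗ[ℂ] A) : Prop :=
  ∀ a b : A, LinearMap.mul' ℂ A (S.rTensor A (H.T₁ (a ⊗ₜ b))) = H.counit a • b ∧
    LinearMap.mul' ℂ A (S.lTensor A (H.T₂ (a ⊗ₜ b))) = H.counit b • a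

/-- The antipode: the unique linear map `S : A → A` with `IsAntipode`. (For a regular multiplier
Hopf algebra the antipode takes its values in `A` and is an anti-automorphism of `A`.) -/
noncomputable def antipode : A →ₗ[ℂ] A := Classical.epsilon H.IsAntipode

/-- The equations `T(m)S(a) = S(am)` and `S(a)T(m) = S(ma)` in `A`, which say that the linear map
`T : M(A) → M(A)` extends the anti-automorphism `S` of `A`. -/
def IsAntipodeExtension (T : Multiplier A →ₗ[ℂ] Multiplier A) : Prop :=
  ∀ (m : Multiplier A) (a : A), left (T m) (H.antipode a) = H.antipode (right m a) ∧
    right (T m) (H.antipode a) = H.antipode (left m a)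

/-- The extension of the antipode to `M(A)`: the unique linear map with `IsAntipodeExtension`. -/
noncomputable def antipodeM : Multiplier A →ₗ[ℂ] Multiplier A :=
  Classical.epsilon H.IsAntipodeExtension

/-- The linear map `A ⊗ M(A) → A`, `x ⊗ m ↦ S(m)x`. -/
noncomputable def antipodeContract : A ⊗[ℂ] Multiplier A →ₗ[ℂ] A :=
  TensorProduct.lift (left ∘ₗ H.antipodeM).flip

/-- The map `a ↦ ua = ∑ S(R⁽²⁾)R⁽¹⁾a`, where `R(a ⊗ 1) = ∑ R⁽¹⁾a ⊗ R⁽²⁾` in `A ⊗ M(A)`. -/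
noncomputable def drinfeldMap (R : Multiplier (A ⊗[ℂ] A))
    (hR : ∀ a : A, R * tmul (of a) 1 ∈ LinearMap.range (ofTensor (A := A))) (a : A) : A :=
  H.antipodeContract (LinearMap.mem_range.1 (hR a)).choose

/-- The value of `drinfeldMap` does not depend on how `R(a ⊗ 1)` is written. -/
theorem drinfeldMap_eq (R : Multiplier (A ⊗[ℂ] A))
    (hR : ∀ a : A, R * tmul (of a) 1 ∈ LinearMap.range (ofTensor (A := A))) (a : A)
    (w : A ⊗[ℂ] Multiplier A) (hw : ofTensor w = R * tmul (of a) 1) :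
    H.drinfeldMap R hR a = H.antipodeContract w := by
  unfold drinfeldMap
  congr 1
  apply ofTensor_injective H.eq_zero_of_forall_mul_eq_zero
  rw [(LinearMap.mem_range.1 (hR a)).choose_spec, hw]

end RegularMultiplierHopfAlgebra

/-! Put F(z) = E(σ(Rz)) on A ⊗ A, where σ is the flip and E(a ⊗ b) = S(a)b. Two facts about F give
everything: F(b ⊗ c) = S(c)·ub (`antipode_mul_drinfeldMap`), and F(Δ(a)z) = ε(a)F(z). The second
holds because RΔ(a) = Δ^cop(a)R, the flip turns Δ^cop(a) into Δ(a), and E(Δ(a)z) = ε(a)E(z)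
(`antipodeMul_left_Δ`). Taking z = b ⊗ c and using surjectivity of T₁ gives u(pb) = S²(p)·ub, which
also forces the right action of u to be a ↦ uS⁻²(a).

If R is invertible, F is surjective, while its values S(c)·ub = u(S⁻¹(c)b) lie in uA; so uA = A, and
injectivity follows from non-degeneracy. No formula for u⁻¹ is needed.

The counit and antipode are chosen by `Classical.epsilon`, so their existence has to be proved: ε
comes from T₁⁻¹, T₂⁻¹ and coassociativity, E is (ε ⊗ ι)T₁⁻¹, and regularity makes S take values in A
and be bijective. -/

/-! ### Non-degeneracy of the tensor square. -/

section NonUnital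

open Multiplier TensorProduct

variable {A : Type*} [NonUnitalRing A] [Module ℂ A] [SMulCommClass ℂ A A] [IsScalarTower ℂ A A]

/-- The tensor square of an algebra with left non-degenerate product is left non-degenerate. -/
theorem TensorProduct.eq_zero_of_forall_mul_tmul_eq_zero
    (h : ∀ a : A, (∀ b, a * b = 0) → a = 0) (w : A ⊗[ℂ] A)
    (hw : ∀ p q : A, w * p ⊗ₜ q = 0) : w = 0 := by
  have key (φ : A →ₗ[ℂ] ℂ) (p q : A) (y : A ⊗[ℂ] A) :
      TensorProduct.rid ℂ A (φ.lTensor A (y * p ⊗ₜ q)) =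
        TensorProduct.rid ℂ A ((φ ∘ₗ LinearMap.mulRight ℂ q).lTensor A y) * p := by
    induction y with
    | zero => simp
    | add y y' hy hy' => simp only [map_add, add_mul, hy, hy']
    | tmul a m => simp [smul_mul_assoc]
  have hF (φ : A →ₗ[ℂ] ℂ) (q : A) :
      TensorProduct.rid ℂ A ((φ ∘ₗ LinearMap.mulRight ℂ q).lTensor A w) = 0 :=
    h _ fun p => by rw [← key, hw]; simp
  have swap (φ ψ : A →ₗ[ℂ] ℂ) (q : A) (y : A ⊗[ℂ] A) :
      φ (TensorProduct.lid ℂ _ (ψ.rTensor _ y) * q) =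
        ψ (TensorProduct.rid ℂ A ((φ ∘ₗ LinearMap.mulRight ℂ q).lTensor A y)) := by
    induction y with
    | zero => simp
    | add y y' hy hy' => simp only [map_add, add_mul, hy, hy']
    | tmul a m => simp [mul_comm, smul_mul_assoc]
  have hs (ψ : A →ₗ[ℂ] ℂ) : TensorProduct.lid ℂ _ (ψ.rTensor _ w) = (0 : A) := by
    refine h _ fun q => (Module.forall_dual_apply_eq_zero_iff ℂ _).1 fun φ => ?_
    rw [swap, hF, map_zero]
  let B := Module.Free.chooseBasis ℂ A
  apply (TensorProduct.equivFinsuppOfBasisLeft B).injective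
  ext1 i
  rw [TensorProduct.equivFinsuppOfBasisLeft_apply, hs]
  simp

theorem TensorProduct.eq_of_forall_mul_tmul
    (h : ∀ a : A, (∀ b, a * b = 0) → a = 0) {v w : A ⊗[ℂ] A}
    (hvw : ∀ p q : A, v * p ⊗ₜ q = w * p ⊗ₜ q) : v = w :=
  sub_eq_zero.1 <| TensorProduct.eq_zero_of_forall_mul_tmul_eq_zero h _ fun p q => by
    rw [sub_mul, hvw, sub_self]

theorem TensorProduct.rTensor_mulRight_mul (x p q : A) (w : A ⊗[ℂ] A) :
    (LinearMap.mulRight ℂ x).rTensor A w * p ⊗ₜ q = w * (x * p) ⊗ₜ q := by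
  induction w with
  | zero => simp
  | add w w' hw hw' => simp only [map_add, add_mul, hw, hw']
  | tmul a b => simp [mul_assoc]

theorem TensorProduct.lTensor_mulRight_mul (y p q : A) (w : A ⊗[ℂ] A) :
    (LinearMap.mulRight ℂ y).lTensor A w * p ⊗ₜ q = w * p ⊗ₜ (y * q) := by
  induction w with
  | zero => simp
  | add w w' hw hw' => simp only [map_add, add_mul, hw, hw']
  | tmul a b => simp [mul_assoc]

theorem TensorProduct.rTensor_mulLeft_mul (a : A) (v w : A ⊗[ℂ] A) :
    (LinearMap.mulLeft ℂ a).rTensor A v * w = (LinearMap.mulLeft ℂ a).rTensor A (v * w) :=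
  (left_mul' (Multiplier.tmul (of a) 1) v w).symm

end NonUnital

/-! ### The maps T₁ and T₂ and coassociativity. -/

namespace MultiplierHopfAlgebra

open Multiplier TensorProduct

variable {A : Type*} [NonUnitalRing A] [Module ℂ A] [SMulCommClass ℂ A A] [IsScalarTower ℂ A A]
  (H : MultiplierHopfAlgebra A)

theorem T₁_mul_tmul (a b p q : A) :
    H.T₁ (a ⊗ₜ b) * p ⊗ₜ q = left (H.Δ a) (p ⊗ₜ (b * q)) := by
  rw [← left_of, H.of_T₁]; rfl

theorem T₂_mul (a b : A) (z : A ⊗[ℂ] A) :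
    H.T₂ (a ⊗ₜ b) * z = (LinearMap.mulLeft ℂ a).rTensor A (left (H.Δ b) z) := by
  rw [← left_of, H.of_T₂]; rfl

theorem left_Δ_mul (a b : A) (z : A ⊗[ℂ] A) :
    left (H.Δ (a * b)) z = left (H.Δ a) (left (H.Δ b) z) := by
  rw [map_mul, left_mul_apply]

theorem left_Δ_tmul (a x y : A) :
    left (H.Δ a) (x ⊗ₜ y) = (LinearMap.mulRight ℂ x).rTensor A (H.T₁ (a ⊗ₜ y)) := by
  refine eq_of_forall_mul_tmul H.eq_zero_of_forall_mul_eq_zero fun p q => ?_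
  rw [rTensor_mulRight_mul, T₁_mul_tmul, ← left_mul', Algebra.TensorProduct.tmul_mul_tmul]

/-- Multiplicativity of Δ in terms of T₁. Since T₁ is onto, an identity about Δ(a)z need only be
checked at z = T₁(b ⊗ c), where this applies. -/
theorem left_Δ_T₁ (a b c : A) : left (H.Δ a) (H.T₁ (b ⊗ₜ c)) = H.T₁ ((a * b) ⊗ₜ c) := by
  refine eq_of_forall_mul_tmul H.eq_zero_of_forall_mul_eq_zero fun p q => ?_
  rw [← left_mul', T₁_mul_tmul, T₁_mul_tmul, left_Δ_mul]

theorem T₁_tmul_mul (a b c : A) :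
    H.T₁ (a ⊗ₜ (b * c)) = (LinearMap.mulRight ℂ c).lTensor A (H.T₁ (a ⊗ₜ b)) := by
  refine eq_of_forall_mul_tmul H.eq_zero_of_forall_mul_eq_zero fun p q => ?_
  rw [lTensor_mulRight_mul, T₁_mul_tmul, T₁_mul_tmul, mul_assoc]

theorem lTensor_mulRight_T₂ (a b c : A) :
    (LinearMap.mulRight ℂ c).lTensor A (H.T₂ (a ⊗ₜ b)) =
      (LinearMap.mulLeft ℂ a).rTensor A (H.T₁ (b ⊗ₜ c)) := by
  refine eq_of_forall_mul_tmul H.eq_zero_of_forall_mul_eq_zero fun p q => ?_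
  rw [lTensor_mulRight_mul, T₂_mul, rTensor_mulLeft_mul, T₁_mul_tmul]

theorem comm_T₁_mul_tmul {H K : MultiplierHopfAlgebra A} (hK : ∀ a, K.Δ a = (H.Δ a).flip)
    (a b p q : A) :
    TensorProduct.comm ℂ A A (K.T₁ (a ⊗ₜ b)) * p ⊗ₜ q = left (H.Δ a) ((b * p) ⊗ₜ q) := by
  have h := congrArg (TensorProduct.comm ℂ A A) (K.T₁_mul_tmul a b q p)
  rw [comm_mul', comm_tmul] at h
  rw [h, hK]
  simp [Multiplier.flip, left_mk]

/-- The use of regularity: Δ(a)(x ⊗ 1) is itself an element of A ⊗ A, namely the flip of T₁(a ⊗ x)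
for Δ^cop. -/
theorem left_Δ_tmul_eq_comm_T₁ {H K : MultiplierHopfAlgebra A} (hK : ∀ a, K.Δ a = (H.Δ a).flip)
    (a x y : A) :
    left (H.Δ a) (x ⊗ₜ y) =
      (LinearMap.mulRight ℂ y).lTensor A (TensorProduct.comm ℂ A A (K.T₁ (a ⊗ₜ x))) := by
  refine eq_of_forall_mul_tmul H.eq_zero_of_forall_mul_eq_zero fun p q => ?_
  rw [lTensor_mulRight_mul, comm_T₁_mul_tmul hK, ← left_mul', Algebra.TensorProduct.tmul_mul_tmul]

theorem rTensor_mulRight_T₂ {H K : MultiplierHopfAlgebra A} (hK : ∀ a, K.Δ a = (H.Δ a).flip)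
    (a b c : A) :
    (LinearMap.mulRight ℂ c).rTensor A (H.T₂ (a ⊗ₜ b)) =
      (LinearMap.mulLeft ℂ a).rTensor A (TensorProduct.comm ℂ A A (K.T₁ (b ⊗ₜ c))) := by
  refine eq_of_forall_mul_tmul H.eq_zero_of_forall_mul_eq_zero fun p q => ?_
  rw [rTensor_mulRight_mul, T₂_mul, rTensor_mulLeft_mul, comm_T₁_mul_tmul hK]

/-- Coassociativity, solved for `T₁⁻¹`. -/
theorem lTensor_T₁_symm_assoc (a b c : A) :
    H.T₁.symm.toLinearMap.lTensor A (TensorProduct.assoc ℂ A A A (H.T₂ (a ⊗ₜ b) ⊗ₜ c)) =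
      TensorProduct.assoc ℂ A A A (H.T₂.toLinearMap.rTensor A
        ((TensorProduct.assoc ℂ A A A).symm (a ⊗ₜ H.T₁.symm (b ⊗ₜ c)))) := by
  have key (w : A ⊗[ℂ] A) :
      TensorProduct.assoc ℂ A A A (H.T₂.toLinearMap.rTensor A
        ((TensorProduct.assoc ℂ A A A).symm (a ⊗ₜ H.T₁ w))) =
      H.T₁.toLinearMap.lTensor A (TensorProduct.assoc ℂ A A A (H.T₂.toLinearMap.rTensor A
        ((TensorProduct.assoc ℂ A A A).symm (a ⊗ₜ w)))) := by
    induction w with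
    | zero => simp
    | add w w' hw hw' => simp only [map_add, tmul_add, hw, hw']
    | tmul b c => rw [H.coassoc]; simp
  have h := key (H.T₁.symm (b ⊗ₜ c))
  rw [LinearEquiv.apply_symm_apply, assoc_symm_tmul, LinearMap.rTensor_tmul] at h
  have h2 := congrArg (H.T₁.symm.toLinearMap.lTensor A) h
  rw [← LinearMap.comp_apply (H.T₁.symm.toLinearMap.lTensor A), ← LinearMap.lTensor_comp] at h2
  simpa using h2

/-- Apply ι ⊗ mT₁⁻¹ to T₂(a ⊗ b) ⊗ c: coassociativity moves T₁⁻¹ past T₂, and what remains collapses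
to ab ⊗ c. The equality separates variables, so both products are scalar multiples, by the same
scalar depending on q alone; that scalar is ε(q). -/
theorem tmul_mul'_T₁_symm (p q c : A) :
    p ⊗ₜ[ℂ] LinearMap.mul' ℂ A (H.T₁.symm (q ⊗ₜ c)) =
      LinearMap.mul' ℂ A (H.T₂.symm (p ⊗ₜ q)) ⊗ₜ c := by
  have h1 (a : A) (w : A ⊗[ℂ] A) :
      (LinearMap.mul' ℂ A).lTensor A (TensorProduct.assoc ℂ A A A (H.T₂.toLinearMap.rTensor A
        ((TensorProduct.assoc ℂ A A A).symm (a ⊗ₜ w)))) =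
      (LinearMap.mulLeft ℂ a).rTensor A (H.T₁ w) := by
    induction w with
    | zero => simp
    | add w w' hw hw' => simp only [map_add, tmul_add, hw, hw']
    | tmul b c =>
      rw [← lTensor_mulRight_T₂, assoc_symm_tmul, LinearMap.rTensor_tmul, LinearEquiv.coe_coe]
      induction H.T₂ (a ⊗ₜ b) with
      | zero => simp
      | add w w' hw hw' => simp only [map_add, add_tmul, hw, hw']
      | tmul x y => simp
  have h2 (w : A ⊗[ℂ] A) :
      (LinearMap.mul' ℂ A ∘ₗ H.T₁.symm.toLinearMap).lTensor A
        (TensorProduct.assoc ℂ A A A (H.T₂ w ⊗ₜ c)) = LinearMap.mul' ℂ A w ⊗ₜ c := by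
    induction w with
    | zero => simp
    | add w w' hw hw' => simp only [map_add, add_tmul, hw, hw']
    | tmul a b =>
      rw [LinearMap.lTensor_comp, LinearMap.comp_apply, lTensor_T₁_symm_assoc, h1]
      simp
  simpa using h2 (H.T₂.symm (p ⊗ₜ q))

end MultiplierHopfAlgebra

/-! ### Existence of the counit. -/

namespace RegularMultiplierHopfAlgebra

open Multiplier TensorProduct

variable {A : Type*} [NonUnitalRing A] [Module ℂ A] [SMulCommClass ℂ A A] [IsScalarTower ℂ A A]
  (H : RegularMultiplierHopfAlgebra A)

theorem exists_isCounit : ∃ ε, H.IsCounit ε := by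
  cases subsingleton_or_nontrivial A with
  | inl _ => exact ⟨0, fun a b => ⟨Subsingleton.elim _ _, Subsingleton.elim _ _⟩⟩
  | inr _ =>
    obtain ⟨p, hp⟩ := exists_ne (0 : A)
    obtain ⟨φ, hφ⟩ : ∃ φ : A →ₗ[ℂ] ℂ, φ p = 1 :=
      Module.Projective.exists_dual_eq_one ℂ hp
    -- Read off the scalar from mT₂⁻¹(p ⊗ q) = ε(q)p with a functional normalised at p.
    let ε : A →ₗ[ℂ] ℂ :=
      φ ∘ₗ LinearMap.mul' ℂ A ∘ₗ H.T₂.symm.toLinearMap ∘ₗ TensorProduct.mk ℂ A A p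
    have h1 (q c : A) : LinearMap.mul' ℂ A (H.T₁.symm (q ⊗ₜ c)) = ε q • c := by
      simpa [hφ, ε] using congrArg (fun w => TensorProduct.lid ℂ A (φ.rTensor A w))
        (H.tmul_mul'_T₁_symm p q c)
    have h2 (r q : A) : LinearMap.mul' ℂ A (H.T₂.symm (r ⊗ₜ q)) = ε q • r := by
      simpa [hφ, h1] using (congrArg (fun w => TensorProduct.rid ℂ A (φ.lTensor A w))
        (H.tmul_mul'_T₁_symm r q p)).symm
    have h3 (w : A ⊗[ℂ] A) : TensorProduct.lid ℂ A (ε.rTensor A w) =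
        LinearMap.mul' ℂ A (H.T₁.symm w) := by
      induction w with
      | zero => simp
      | add w w' hw hw' => simp only [map_add, hw, hw']
      | tmul q c => simp [h1]
    have h4 (w : A ⊗[ℂ] A) : TensorProduct.rid ℂ A (ε.lTensor A w) =
        LinearMap.mul' ℂ A (H.T₂.symm w) := by
      induction w with
      | zero => simp
      | add w w' hw hw' => simp only [map_add, hw, hw']
      | tmul q c => simp [h2]
    exact ⟨ε, fun a b => ⟨by simp [h3], by simp [h4]⟩⟩

theorem isCounit_counit : H.IsCounit H.counit := Classical.epsilon_spec H.exists_isCounit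

end RegularMultiplierHopfAlgebra

/-! ### Properties of the counit. -/

namespace RegularMultiplierHopfAlgebra

open Multiplier TensorProduct

variable {A : Type*} [NonUnitalRing A] [Module ℂ A] [SMulCommClass ℂ A A] [IsScalarTower ℂ A A]
  (H : RegularMultiplierHopfAlgebra A)

theorem lid_rTensor_counit_T₁ (w : A ⊗[ℂ] A) :
    TensorProduct.lid ℂ A (H.counit.rTensor A (H.T₁ w)) = LinearMap.mul' ℂ A w := by
  induction w with
  | zero => simp
  | add w w' hw hw' => simp only [map_add, hw, hw']
  | tmul a b => simpa using (H.isCounit_counit a b).1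

theorem rid_lTensor_counit_T₂ (w : A ⊗[ℂ] A) :
    TensorProduct.rid ℂ A (H.counit.lTensor A (H.T₂ w)) = LinearMap.mul' ℂ A w := by
  induction w with
  | zero => simp
  | add w w' hw hw' => simp only [map_add, hw, hw']
  | tmul a b => simpa using (H.isCounit_counit a b).2

theorem eq_counit_of_T₁ {ε : A →ₗ[ℂ] ℂ}
    (hε : ∀ a b : A, TensorProduct.lid ℂ A (ε.rTensor A (H.T₁ (a ⊗ₜ b))) = a * b) :
    ε = H.counit := by
  cases subsingleton_or_nontrivial A with
  | inl _ => exact LinearMap.ext fun a => by rw [Subsingleton.elim a 0, map_zero, map_zero]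
  | inr _ =>
    obtain ⟨y, hy⟩ := exists_ne (0 : A)
    have h (w : A ⊗[ℂ] A) : TensorProduct.lid ℂ A (ε.rTensor A (H.T₁ w)) =
        TensorProduct.lid ℂ A (H.counit.rTensor A (H.T₁ w)) := by
      induction w with
      | zero => simp
      | add w w' hw hw' => simp only [map_add, hw, hw']
      | tmul a b => rw [hε, (H.isCounit_counit a b).1]
    ext a
    have := h (H.T₁.symm (a ⊗ₜ y))
    simp only [LinearEquiv.apply_symm_apply, LinearMap.rTensor_tmul, lid_tmul] at this
    exact smul_left_injective ℂ hy this

theorem lid_rTensor_counit_left_Δ (a : A) (z : A ⊗[ℂ] A) :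
    TensorProduct.lid ℂ A (H.counit.rTensor A (left (H.Δ a) z)) =
      a * TensorProduct.lid ℂ A (H.counit.rTensor A z) := by
  obtain ⟨w, rfl⟩ := H.T₁.surjective z
  induction w with
  | zero => simp
  | add w w' hw hw' => simp only [map_add, mul_add, hw, hw']
  | tmul b c =>
    rw [H.left_Δ_T₁, lid_rTensor_counit_T₁, lid_rTensor_counit_T₁]
    simp [mul_assoc]

/-- Compute (ε ⊗ ι)(Δ(a)(b ⊗ y)) = aε(b)y = ε(b)(ε ⊗ ι)T₁(a ⊗ y); surjectivity of T₁ then replaces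
T₁(a ⊗ y) by any tensor. -/
theorem counit_mul (a b : A) : H.counit (a * b) = H.counit a * H.counit b := by
  have h (w : A ⊗[ℂ] A) :
      TensorProduct.lid ℂ A (H.counit.rTensor A ((LinearMap.mulRight ℂ b).rTensor A w)) =
        H.counit b • TensorProduct.lid ℂ A (H.counit.rTensor A w) := by
    obtain ⟨w, rfl⟩ := H.T₁.surjective w
    induction w with
    | zero => simp
    | add w w' hw hw' => simp only [map_add, smul_add, hw, hw']
    | tmul a y =>
      rw [← H.left_Δ_tmul, lid_rTensor_counit_left_Δ, lid_rTensor_counit_T₁]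
      simp [mul_smul_comm]
  cases subsingleton_or_nontrivial A with
  | inl _ => rw [Subsingleton.elim a 0]; simp
  | inr _ =>
    obtain ⟨y, hy⟩ := exists_ne (0 : A)
    refine smul_left_injective ℂ hy ?_
    simpa [smul_smul, mul_comm] using h (a ⊗ₜ y)

theorem exists_counit_eq_one [Nontrivial A] : ∃ p, H.counit p = 1 := by
  by_contra! h
  have h0 : H.counit = 0 := by
    ext a
    by_contra ha
    exact h ((H.counit a)⁻¹ • a) (by simpa using inv_mul_cancel₀ ha)
  obtain ⟨a, ha⟩ := exists_ne (0 : A)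
  refine ha (H.eq_zero_of_forall_mul_eq_zero a fun b => ?_)
  rw [← (H.isCounit_counit a b).1, h0]
  simp

/-- The T₁ equation alone determines a counit, and for Δ^cop it is the T₂ equation of Δ, flipped. -/
theorem counit_eq_of_flip {H K : RegularMultiplierHopfAlgebra A}
    (hK : ∀ a, K.Δ a = (H.Δ a).flip) : K.counit = H.counit := by
  refine (K.eq_counit_of_T₁ fun a b => ?_).symm
  rw [← sub_eq_zero]
  refine H.eq_zero_of_forall_mul_eq_zero' _ fun c => ?_
  have h1 (w : A ⊗[ℂ] A) :
      TensorProduct.rid ℂ A (H.counit.lTensor A ((LinearMap.mulLeft ℂ c).rTensor A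
        (TensorProduct.comm ℂ A A w))) =
      c * TensorProduct.lid ℂ A (H.counit.rTensor A w) := by
    induction w with
    | zero => simp
    | add w w' hw hw' => simp only [map_add, mul_add, hw, hw']
    | tmul x y => simp [mul_smul_comm]
  have h2 (w : A ⊗[ℂ] A) :
      TensorProduct.rid ℂ A (H.counit.lTensor A ((LinearMap.mulRight ℂ b).rTensor A w)) =
      TensorProduct.rid ℂ A (H.counit.lTensor A w) * b := by
    induction w with
    | zero => simp
    | add w w' hw hw' => simp only [map_add, add_mul, hw, hw']
    | tmul x y => simp [smul_mul_assoc]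
  rw [mul_sub, ← h1, ← MultiplierHopfAlgebra.rTensor_mulRight_T₂ hK, h2, rid_lTensor_counit_T₂]
  simp [mul_assoc]

/-! ### The antipode: existence, anti-multiplicativity and bijectivity. -/

/-- The linear map `a ⊗ b ↦ S(a)b`, given by `(ε ⊗ ι) ∘ T₁⁻¹`. -/
noncomputable def antipodeMul : A ⊗[ℂ] A →ₗ[ℂ] A :=
  (TensorProduct.lid ℂ A).toLinearMap ∘ₗ H.counit.rTensor A ∘ₗ H.T₁.symm.toLinearMap

theorem antipodeMul_T₁ (w : A ⊗[ℂ] A) :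
    H.antipodeMul (H.T₁ w) = TensorProduct.lid ℂ A (H.counit.rTensor A w) := by
  simp [antipodeMul]

theorem antipodeMul_surjective : Function.Surjective H.antipodeMul := fun a => by
  cases subsingleton_or_nontrivial A with
  | inl _ => exact ⟨0, Subsingleton.elim _ _⟩
  | inr _ =>
    obtain ⟨p, hp⟩ := H.exists_counit_eq_one
    exact ⟨H.T₁ (p ⊗ₜ a), by simp [antipodeMul_T₁, hp]⟩

theorem antipodeMul_lTensor_mulRight (c : A) (w : A ⊗[ℂ] A) :
    H.antipodeMul ((LinearMap.mulRight ℂ c).lTensor A w) = H.antipodeMul w * c := by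
  obtain ⟨w, rfl⟩ := H.T₁.surjective w
  induction w with
  | zero => simp
  | add w w' hw hw' => simp only [map_add, add_mul, hw, hw']
  | tmul a b =>
    rw [← H.T₁_tmul_mul, antipodeMul_T₁, antipodeMul_T₁]
    simp [smul_mul_assoc]

/-- In Sweedler notation, S(a₁x)a₂y = S(x)S(a₁)a₂y = ε(a)S(x)y. Here it follows from
multiplicativity of ε instead, before S is available. -/
theorem antipodeMul_left_Δ (a : A) (z : A ⊗[ℂ] A) :
    H.antipodeMul (left (H.Δ a) z) = H.counit a • H.antipodeMul z := by
  obtain ⟨w, rfl⟩ := H.T₁.surjective z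
  induction w with
  | zero => simp
  | add w w' hw hw' => simp only [map_add, smul_add, hw, hw']
  | tmul b c =>
    rw [H.left_Δ_T₁, antipodeMul_T₁, antipodeMul_T₁]
    simp [counit_mul, smul_smul]

/-- With ε(p) = 1, S(a) is the value of `antipodeMul` at Δ(p)(a ⊗ 1), which regularity places in A ⊗
A. -/
theorem exists_forall_mul_eq_antipodeMul :
    ∃ S : A →ₗ[ℂ] A, ∀ a b, S a * b = H.antipodeMul (a ⊗ₜ b) := by
  cases subsingleton_or_nontrivial A with
  | inl _ => exact ⟨0, fun a b => Subsingleton.elim _ _⟩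
  | inr _ =>
    obtain ⟨K, hK⟩ := H.regular
    obtain ⟨p, hp⟩ := H.exists_counit_eq_one
    refine ⟨H.antipodeMul ∘ₗ (TensorProduct.comm ℂ A A).toLinearMap ∘ₗ K.T₁.toLinearMap ∘ₗ
      TensorProduct.mk ℂ A A p, fun a b => ?_⟩
    simp only [LinearMap.comp_apply, TensorProduct.mk_apply, LinearEquiv.coe_coe]
    rw [← antipodeMul_lTensor_mulRight, ← MultiplierHopfAlgebra.left_Δ_tmul_eq_comm_T₁ hK,
      antipodeMul_left_Δ, hp, one_smul]

theorem isAntipode_of_forall_mul_eq {S : A →ₗ[ℂ] A}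
    (hS : ∀ a b, S a * b = H.antipodeMul (a ⊗ₜ b)) : H.IsAntipode S := by
  intro a b
  constructor
  · have h : LinearMap.mul' ℂ A ∘ₗ S.rTensor A = H.antipodeMul :=
      TensorProduct.ext' fun a b => by simp [hS]
    rw [← LinearMap.comp_apply, h, antipodeMul_T₁]
    simp
  -- After right multiplication by c, S(·)c is (ε ⊗ ι)T₁⁻¹, and coassociativity exchanges T₁⁻¹ with
  -- T₂; the counit equations finish.
  · rw [← sub_eq_zero]
    refine H.eq_zero_of_forall_mul_eq_zero _ fun c => ?_
    have h1 (v : A ⊗[ℂ] A) : LinearMap.mul' ℂ A (S.lTensor A v) * c =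
        LinearMap.mul' ℂ A (H.antipodeMul.lTensor A (TensorProduct.assoc ℂ A A A (v ⊗ₜ c))) := by
      induction v with
      | zero => simp
      | add w w' hw hw' => simp only [map_add, add_mul, add_tmul, hw, hw']
      | tmul x y => simp [mul_assoc, hS]
    have h2 (v : A ⊗[ℂ] A) (q : A) :
        ((TensorProduct.lid ℂ A).toLinearMap ∘ₗ H.counit.rTensor A).lTensor A
          (TensorProduct.assoc ℂ A A A (v ⊗ₜ q)) =
        TensorProduct.rid ℂ A (H.counit.lTensor A v) ⊗ₜ q := by
      induction v with
      | zero => simp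
      | add w w' hw hw' => simp only [map_add, add_tmul, hw, hw']
      | tmul x y => simp [smul_tmul]
    have h3 (w : A ⊗[ℂ] A) :
        LinearMap.mul' ℂ A (((TensorProduct.lid ℂ A).toLinearMap ∘ₗ H.counit.rTensor A).lTensor A
          (TensorProduct.assoc ℂ A A A (H.T₂.toLinearMap.rTensor A
            ((TensorProduct.assoc ℂ A A A).symm (a ⊗ₜ w))))) = a * LinearMap.mul' ℂ A w := by
      induction w with
      | zero => simp
      | add w w' hw hw' => simp only [map_add, tmul_add, mul_add, hw, hw']
      | tmul p q =>
        rw [assoc_symm_tmul, LinearMap.rTensor_tmul, h2, LinearEquiv.coe_coe,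
          rid_lTensor_counit_T₂]
        simp [mul_assoc]
    have h4 : H.antipodeMul.lTensor A = ((TensorProduct.lid ℂ A).toLinearMap ∘ₗ
        H.counit.rTensor A).lTensor A ∘ₗ H.T₁.symm.toLinearMap.lTensor A := by
      rw [← LinearMap.lTensor_comp]; rfl
    rw [sub_mul, h1, h4, LinearMap.comp_apply, H.lTensor_T₁_symm_assoc, h3,
      ← lid_rTensor_counit_T₁ H]
    simp [mul_smul_comm, smul_mul_assoc]

theorem isAntipode_antipode : H.IsAntipode H.antipode := by
  obtain ⟨S, hS⟩ := H.exists_forall_mul_eq_antipodeMul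
  exact Classical.epsilon_spec ⟨S, H.isAntipode_of_forall_mul_eq hS⟩

theorem mul'_rTensor_antipode (w : A ⊗[ℂ] A) :
    LinearMap.mul' ℂ A (H.antipode.rTensor A w) = H.antipodeMul w := by
  obtain ⟨w, rfl⟩ := H.T₁.surjective w
  induction w with
  | zero => simp
  | add w w' hw hw' => simp only [map_add, hw, hw']
  | tmul a b => rw [(H.isAntipode_antipode a b).1, antipodeMul_T₁]; simp

theorem antipode_mul_eq_antipodeMul (a b : A) : H.antipode a * b = H.antipodeMul (a ⊗ₜ b) := by
  simp [← mul'_rTensor_antipode]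

/-- Evaluating `antipodeMul` at Δ(p)(b ⊗ q) gives ε(p)S(b)q, which is S(b) times its value at T₁(p ⊗
q). -/
theorem antipode_mul (a b : A) : H.antipode (a * b) = H.antipode b * H.antipode a := by
  rw [← sub_eq_zero]
  refine H.eq_zero_of_forall_mul_eq_zero _ fun c => ?_
  have h (w : A ⊗[ℂ] A) : H.antipodeMul ((LinearMap.mulRight ℂ b).rTensor A w) =
      H.antipode b * H.antipodeMul w := by
    obtain ⟨w, rfl⟩ := H.T₁.surjective w
    induction w with
    | zero => simp
    | add w w' hw hw' => simp only [map_add, mul_add, hw, hw']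
    | tmul p q =>
      rw [← H.left_Δ_tmul, antipodeMul_left_Δ, antipodeMul_T₁, ← antipode_mul_eq_antipodeMul]
      simp [mul_smul_comm]
  rw [sub_mul, mul_assoc, antipode_mul_eq_antipodeMul, antipode_mul_eq_antipodeMul H a, ← h]
  simp

/-- The second antipode equation with ε(p) = 1 writes every a as a sum of products xS(y), so az = 0
for all a. -/
theorem eq_zero_of_forall_antipode_mul_eq_zero {z : A} (hz : ∀ x, H.antipode x * z = 0) :
    z = 0 := by
  cases subsingleton_or_nontrivial A with
  | inl _ => exact Subsingleton.elim _ _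
  | inr _ =>
    obtain ⟨p, hp⟩ := H.exists_counit_eq_one
    refine H.eq_zero_of_forall_mul_eq_zero' _ fun a => ?_
    have h (v : A ⊗[ℂ] A) : LinearMap.mul' ℂ A (H.antipode.lTensor A v) * z = 0 := by
      induction v with
      | zero => simp
      | add w w' hw hw' => simp only [map_add, add_mul, hw, hw', add_zero]
      | tmul x y => simp [mul_assoc, hz]
    simpa [(H.isAntipode_antipode a p).2, hp] using h (H.T₂ (a ⊗ₜ p))

theorem eq_of_forall_antipode_mul {x y : A} (h : ∀ c, H.antipode c * x = H.antipode c * y) :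
    x = y :=
  sub_eq_zero.1 <| H.eq_zero_of_forall_antipode_mul_eq_zero fun c => by rw [mul_sub, h, sub_self]

/-- Writing S' for the antipode of Δ^cop, `h2` says S(S'(x)y) = S(y)x; expanding the left side and
cancelling S(y) gives SS' = ι. -/
theorem antipode_antipode_of_flip {H K : RegularMultiplierHopfAlgebra A}
    (hK : ∀ a, K.Δ a = (H.Δ a).flip) (y : A) : H.antipode (K.antipode y) = y := by
  have h1 (a b : A) : H.antipodeMul (TensorProduct.comm ℂ A A (K.T₁ (a ⊗ₜ b))) =
      H.counit a • H.antipode b := by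
    rw [← sub_eq_zero]
    refine H.eq_zero_of_forall_mul_eq_zero _ fun c => ?_
    rw [sub_mul, ← antipodeMul_lTensor_mulRight, ← MultiplierHopfAlgebra.left_Δ_tmul_eq_comm_T₁ hK,
      antipodeMul_left_Δ, smul_mul_assoc, antipode_mul_eq_antipodeMul, sub_self]
  have h2 (w : A ⊗[ℂ] A) : H.antipode (K.antipodeMul w) =
      H.antipodeMul (TensorProduct.comm ℂ A A w) := by
    obtain ⟨w, rfl⟩ := K.T₁.surjective w
    induction w with
    | zero => simp
    | add w w' hw hw' => simp only [map_add, hw, hw']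
    | tmul a b => rw [h1, antipodeMul_T₁]; simp [counit_eq_of_flip hK]
  refine H.eq_of_forall_antipode_mul fun x => ?_
  rw [← antipode_mul, antipode_mul_eq_antipodeMul, antipode_mul_eq_antipodeMul, h2, comm_tmul]

theorem exists_flip : ∃ K : RegularMultiplierHopfAlgebra A,
    (∀ a, K.Δ a = (H.Δ a).flip) ∧ ∀ a, H.Δ a = (K.Δ a).flip := by
  obtain ⟨K, hK⟩ := H.regular
  have h (a : A) : H.Δ a = (K.Δ a).flip := by
    rw [hK]
    refine ext_iff'.2 ⟨?_, ?_⟩ <;> ext <;> simp [Multiplier.flip, left_mk, right_mk]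
  exact ⟨⟨K, H.toMultiplierHopfAlgebra, h⟩, hK, h⟩

theorem antipode_bijective : Function.Bijective H.antipode := by
  obtain ⟨K, hK, hH⟩ := H.exists_flip
  exact ⟨Function.LeftInverse.injective (antipode_antipode_of_flip hH),
    Function.RightInverse.surjective (antipode_antipode_of_flip hK)⟩

/-! ### Extension of the antipode to M(A). -/

/-- The antipode as a linear equivalence. -/
noncomputable def antipodeEquiv : A ≃ₗ[ℂ] A :=
  LinearEquiv.ofBijective H.antipode H.antipode_bijective

theorem antipode_antipodeEquiv_symm (a : A) : H.antipode (H.antipodeEquiv.symm a) = a :=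
  H.antipodeEquiv.apply_symm_apply a

theorem antipodeEquiv_symm_antipode (a : A) : H.antipodeEquiv.symm (H.antipode a) = a :=
  H.antipodeEquiv.symm_apply_apply a

theorem antipodeEquiv_symm_mul (a b : A) :
    H.antipodeEquiv.symm (a * b) = H.antipodeEquiv.symm b * H.antipodeEquiv.symm a :=
  H.antipode_bijective.1 <| by simp only [antipode_mul, antipode_antipodeEquiv_symm]

theorem exists_isAntipodeExtension : ∃ T, H.IsAntipodeExtension T := by
  refine ⟨{ toFun := fun m => Multiplier.mk
              (H.antipode ∘ₗ right m ∘ₗ H.antipodeEquiv.symm.toLinearMap)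
              (H.antipode ∘ₗ left m ∘ₗ H.antipodeEquiv.symm.toLinearMap)
              (fun a b => ?_) (fun a b => ?_) (fun a b => ?_)
            map_add' := fun m n => ext_iff'.2 ⟨?_, ?_⟩
            map_smul' := fun c m => ext_iff'.2 ⟨?_, ?_⟩ }, fun m a => ⟨?_, ?_⟩⟩
  · simp [antipodeEquiv_symm_mul, right_mul', antipode_mul, antipode_antipodeEquiv_symm]
  · simp [antipodeEquiv_symm_mul, left_mul', antipode_mul, antipode_antipodeEquiv_symm]
  · obtain ⟨a, rfl⟩ := H.antipode_bijective.2 a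
    obtain ⟨b, rfl⟩ := H.antipode_bijective.2 b
    simp [← antipode_mul, antipodeEquiv_symm_antipode, right_mul_eq]
  all_goals first | (ext x; simp [left_mk, right_mk]) |
    simp [left_mk, right_mk, antipodeEquiv_symm_antipode]

theorem isAntipodeExtension_antipodeM : H.IsAntipodeExtension H.antipodeM :=
  Classical.epsilon_spec H.exists_isAntipodeExtension

end RegularMultiplierHopfAlgebra

/-! ### Invertibility and linearity of multipliers. -/

section NonUnital

open Multiplier TensorProduct

variable {A : Type*} [NonUnitalRing A] [Module ℂ A] [SMulCommClass ℂ A A] [IsScalarTower ℂ A A]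

/-- A multiplier acting bijectively from both sides is invertible. -/
theorem Multiplier.isUnit_of_bijective {m : Multiplier A} (hl : Function.Bijective (left m))
    (hr : Function.Bijective (right m)) : IsUnit m := by
  let L := LinearEquiv.ofBijective (left m) hl
  let R := LinearEquiv.ofBijective (right m) hr
  have hL (a : A) : left m (L.symm a) = a := L.apply_symm_apply a
  have hL' (a : A) : L.symm (left m a) = a := L.symm_apply_apply a
  have hR (a : A) : right m (R.symm a) = a := R.apply_symm_apply a
  have hR' (a : A) : R.symm (right m a) = a := R.symm_apply_apply a
  let n : Multiplier A := Multiplier.mk L.symm.toLinearMap R.symm.toLinearMap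
    (fun a b => hl.1 <| by simp only [left_mul', LinearEquiv.coe_coe, hL])
    (fun a b => hr.1 <| by simp only [right_mul', LinearEquiv.coe_coe, hR])
    (fun a b => by
      simp only [LinearEquiv.coe_coe]
      conv_lhs => rw [← hL b]
      rw [← right_mul_eq, hR])
  exact ⟨⟨m, n, ext_iff'.2 ⟨LinearMap.ext hL, LinearMap.ext hR'⟩,
    ext_iff'.2 ⟨LinearMap.ext hL', LinearMap.ext hR⟩⟩, rfl⟩

theorem Multiplier.left_rTensor_mulRight (h : ∀ a : A, (∀ b, a * b = 0) → a = 0)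
    (m : Multiplier (A ⊗[ℂ] A)) (c : A) (z : A ⊗[ℂ] A) :
    left m ((LinearMap.mulRight ℂ c).rTensor A z) =
      (LinearMap.mulRight ℂ c).rTensor A (left m z) := by
  refine eq_of_forall_mul_tmul h fun p q => ?_
  rw [rTensor_mulRight_mul, ← left_mul', ← left_mul', rTensor_mulRight_mul]

end NonUnital

/-! ### The Drinfeld element. -/

namespace RegularMultiplierHopfAlgebra

open Multiplier TensorProduct

variable {A : Type*} [NonUnitalRing A] [Module ℂ A] [SMulCommClass ℂ A A] [IsScalarTower ℂ A A]
  (H : RegularMultiplierHopfAlgebra A)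

theorem antipodeMul_comm_rTensor_mulRight (p : A) (v : A ⊗[ℂ] A) :
    H.antipodeMul (TensorProduct.comm ℂ A A ((LinearMap.mulRight ℂ p).rTensor A v)) =
      H.antipodeMul (TensorProduct.comm ℂ A A v) * p := by
  rw [← antipodeMul_lTensor_mulRight]
  congr 1
  induction v with
  | zero => simp
  | add w w' hw hw' => simp only [map_add, hw, hw']
  | tmul x y => simp

variable (R : Multiplier (A ⊗[ℂ] A))
  (hR : ∀ a : A, R * tmul (of a) 1 ∈ LinearMap.range (ofTensor (A := A)))

/-- `S(c) · ub = ∑ S(R⁽²⁾c)R⁽¹⁾b`. -/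
theorem antipode_mul_drinfeldMap (b c : A) :
    H.antipode c * H.drinfeldMap R hR b =
      H.antipodeMul (TensorProduct.comm ℂ A A (left R (b ⊗ₜ c))) := by
  obtain ⟨w, hw⟩ := hR b
  rw [H.drinfeldMap_eq R hR b w hw, ← sub_eq_zero]
  -- The factor p lets R(b ⊗ c)(p ⊗ 1) be rewritten as R(b ⊗ 1)(p ⊗ c), where the expansion `w` of
  -- R(b ⊗ 1) can be used.
  refine H.eq_zero_of_forall_mul_eq_zero _ fun p => ?_
  have h1 : (LinearMap.mulRight ℂ p).rTensor A (left R (b ⊗ₜ c)) =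
      left (ofTensor w) (p ⊗ₜ c) := by
    rw [← left_rTensor_mulRight H.eq_zero_of_forall_mul_eq_zero, hw, left_mul_apply]
    simp [Multiplier.tmul, left_mk, left_of, left_one]
  rw [sub_mul, ← antipodeMul_comm_rTensor_mulRight, h1, sub_eq_zero]
  clear hw h1
  induction w with
  | zero => simp
  | add w w' hw hw' => simp only [map_add, LinearMap.add_apply, mul_add, add_mul, hw, hw']
  | tmul x m =>
    simp only [antipodeContract, lift.tmul, LinearMap.flip_apply, LinearMap.comp_apply,
      ofTensor, LinearMap.mk₂_apply, Multiplier.tmul, left_mk, map_tmul, left_of, comm_tmul,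
      ← antipode_mul_eq_antipodeMul]
    rw [← right_mul_eq, (H.isAntipodeExtension_antipodeM m c).2, mul_assoc]

/-- `drinfeldMap` as a linear map. -/
noncomputable def drinfeldLinearMap : A →ₗ[ℂ] A where
  toFun := H.drinfeldMap R hR
  map_add' a b := H.eq_of_forall_antipode_mul fun c => by
    simp only [mul_add, antipode_mul_drinfeldMap, add_tmul, map_add]
  map_smul' r a := H.eq_of_forall_antipode_mul fun c => by
    simp only [mul_smul_comm, antipode_mul_drinfeldMap, ← smul_tmul', map_smul, RingHom.id_apply]

theorem drinfeldMap_mul_right (a b : A) :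
    H.drinfeldMap R hR (a * b) = H.drinfeldMap R hR a * b :=
  H.eq_of_forall_antipode_mul fun c => by
    rw [← mul_assoc, antipode_mul_drinfeldMap, antipode_mul_drinfeldMap,
      ← antipodeMul_comm_rTensor_mulRight,
      ← left_rTensor_mulRight H.eq_zero_of_forall_mul_eq_zero]
    simp

theorem antipodeMul_comm_left_left_Δ {R : Multiplier (A ⊗[ℂ] A)}
    (hcop : ∀ a : A, R * H.Δ a = H.Δcop a * R) (a : A) (z : A ⊗[ℂ] A) :
    H.antipodeMul (TensorProduct.comm ℂ A A (left R (left (H.Δ a) z))) =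
      H.counit a • H.antipodeMul (TensorProduct.comm ℂ A A (left R z)) := by
  rw [← left_mul_apply, hcop, left_mul_apply, ← antipodeMul_left_Δ]
  simp [Δcop, Multiplier.flip, left_mk]

/-- Evaluating F(Δ(a)(b ⊗ c)) = ε(a)S(c)·ub and using that T₁ is onto gives `h`. At v = p ⊗ q it
reads S(q)·u(pb) = S(S(p)q)·ub = S(q)S²(p)·ub, and S(q) cancels. -/
theorem drinfeldMap_mul (hcop : ∀ a : A, R * H.Δ a = H.Δcop a * R) (p b : A) :
    H.drinfeldMap R hR (p * b) =
      H.antipode (H.antipode p) * H.drinfeldMap R hR b := by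
  have h (v : A ⊗[ℂ] A) :
      H.antipodeMul (TensorProduct.comm ℂ A A (left R ((LinearMap.mulRight ℂ b).rTensor A v))) =
        H.antipode (H.antipodeMul v) * H.drinfeldMap R hR b := by
    obtain ⟨v, rfl⟩ := H.T₁.surjective v
    induction v with
    | zero => simp
    | add w w' hw hw' => simp only [map_add, add_mul, hw, hw']
    | tmul a c =>
      rw [← H.left_Δ_tmul, antipodeMul_comm_left_left_Δ H hcop, ← antipode_mul_drinfeldMap H R hR,
        antipodeMul_T₁]
      simp [smul_mul_assoc]
  refine H.eq_of_forall_antipode_mul fun q => ?_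
  rw [antipode_mul_drinfeldMap, ← mul_assoc, ← antipode_mul, antipode_mul_eq_antipodeMul H p, ← h]
  simp

theorem drinfeldMap_bijective (hcop : ∀ a : A, R * H.Δ a = H.Δcop a * R) (hu : IsUnit R) :
    Function.Bijective (H.drinfeldLinearMap R hR) := by
  have hmem (z : A ⊗[ℂ] A) : H.antipodeMul (TensorProduct.comm ℂ A A (left R z)) ∈
      LinearMap.range (H.drinfeldLinearMap R hR) := by
    induction z with
    | zero => simp
    | add w w' hw hw' => simpa only [map_add] using add_mem hw hw'
    | tmul b c =>
      -- S(c) = S²(S⁻¹(c)) can be moved inside u.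
      refine ⟨H.antipodeEquiv.symm c * b, ?_⟩
      rw [← antipode_mul_drinfeldMap H R hR]
      exact (H.drinfeldMap_mul R hR hcop _ _).trans (by rw [antipode_antipodeEquiv_symm])
  have hsurj : Function.Surjective (H.drinfeldLinearMap R hR) := fun a => by
    obtain ⟨v, rfl⟩ := H.antipodeMul_surjective a
    obtain ⟨Q, hQ⟩ := hu.exists_right_inv
    have := hmem (left Q ((TensorProduct.comm ℂ A A).symm v))
    rwa [← left_mul_apply, hQ, left_one, LinearEquiv.apply_symm_apply] at this
  refine ⟨(injective_iff_map_eq_zero _).2 fun b hb => ?_, hsurj⟩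
  -- If ub = 0 then (ua)b = u(ab) = S²(a)·ub = 0, and the elements ua fill A.
  refine H.eq_zero_of_forall_mul_eq_zero' _ fun a => ?_
  obtain ⟨a, rfl⟩ := hsurj a
  change H.drinfeldMap R hR b = 0 at hb
  change H.drinfeldMap R hR a * b = 0
  rw [← drinfeldMap_mul_right, drinfeldMap_mul _ _ _ hcop, hb, mul_zero]

/-- The Drinfeld element `u`, a multiplier with `a u = u S⁻²(a)`. -/
noncomputable def drinfeldElement (hcop : ∀ a : A, R * H.Δ a = H.Δcop a * R) : Multiplier A :=
  Multiplier.mk (H.drinfeldLinearMap R hR)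
    (H.drinfeldLinearMap R hR ∘ₗ H.antipodeEquiv.symm.toLinearMap ∘ₗ
      H.antipodeEquiv.symm.toLinearMap)
    (H.drinfeldMap_mul_right R hR)
    (fun a b => by
      simp only [LinearMap.comp_apply, LinearEquiv.coe_coe, antipodeEquiv_symm_mul]
      exact (H.drinfeldMap_mul R hR hcop _ _).trans
        (by simp only [antipode_antipodeEquiv_symm]; rfl))
    (fun a b => by
      simp only [LinearMap.comp_apply, LinearEquiv.coe_coe]
      refine (H.drinfeldMap_mul_right R hR _ _).symm.trans
        ((H.drinfeldMap_mul R hR hcop _ _).trans ?_)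
      simp only [antipode_antipodeEquiv_symm]; rfl)

theorem left_drinfeldElement (hcop : ∀ a : A, R * H.Δ a = H.Δcop a * R) (a : A) :
    left (H.drinfeldElement R hR hcop) a = H.drinfeldMap R hR a := rfl

theorem right_drinfeldElement_antipode_antipode
    (hcop : ∀ a : A, R * H.Δ a = H.Δcop a * R) (a : A) :
    right (H.drinfeldElement R hR hcop) (H.antipode (H.antipode a)) = H.drinfeldMap R hR a := by
  change H.drinfeldMap R hR (H.antipodeEquiv.symm (H.antipodeEquiv.symm _)) = _
  simp only [antipodeEquiv_symm_antipode]

theorem drinfeldElement_mul_of (hcop : ∀ a : A, R * H.Δ a = H.Δcop a * R) (a : A) :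
    H.drinfeldElement R hR hcop * of a =
      of (H.antipode (H.antipode a)) * H.drinfeldElement R hR hcop := by
  refine ext_iff'.2 ⟨LinearMap.ext fun x => ?_, LinearMap.ext fun x => ?_⟩
  · exact H.drinfeldMap_mul R hR hcop a x
  · obtain ⟨x, rfl⟩ := H.antipode_bijective.2 x
    obtain ⟨x, rfl⟩ := H.antipode_bijective.2 x
    rw [right_mul_apply, right_mul_apply, right_of, right_of, ← antipode_mul, ← antipode_mul,
      right_drinfeldElement_antipode_antipode, right_drinfeldElement_antipode_antipode,
      drinfeldMap_mul_right]

/-- The extended antipode reverses products with elements of `A`. -/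
theorem antipodeM_mul_of (m : Multiplier A) (a b : A) (h : m * of a = of b * m) :
    H.antipodeM m * of (H.antipode b) = of (H.antipode a) * H.antipodeM m := by
  have hT := H.isAntipodeExtension_antipodeM m
  refine ext_iff'.2 ⟨LinearMap.ext fun x => ?_, LinearMap.ext fun x => ?_⟩
  · obtain ⟨x, rfl⟩ := H.antipode_bijective.2 x
    have hx := congrArg (fun n => right n x) h
    simp only [right_mul_apply, right_of] at hx
    rw [left_mul_apply, left_mul_apply, left_of, left_of, ← antipode_mul, (hT _).1, (hT _).1,
      ← hx, antipode_mul]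
  · obtain ⟨x, rfl⟩ := H.antipode_bijective.2 x
    have hx := congrArg (fun n => left n x) h
    simp only [left_mul_apply, left_of] at hx
    rw [right_mul_apply, right_mul_apply, right_of, right_of, ← antipode_mul, (hT _).2, (hT _).2,
      hx, antipode_mul]

/-- Conjugation by the bijection S turns the left action of S(m) into the right action of m, and
conversely. -/
theorem isUnit_antipodeM {m : Multiplier A} (hl : Function.Bijective (left m))
    (hr : Function.Bijective (right m)) : IsUnit (H.antipodeM m) := by
  have hT := H.isAntipodeExtension_antipodeM m
  refine isUnit_of_bijective ?_ ?_
  · refine (Function.Bijective.of_comp_iff _ H.antipode_bijective).1 ?_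
    convert H.antipode_bijective.comp hr using 1
    exact funext fun a => (hT a).1
  · refine (Function.Bijective.of_comp_iff _ H.antipode_bijective).1 ?_
    convert H.antipode_bijective.comp hl using 1
    exact funext fun a => (hT a).2

end RegularMultiplierHopfAlgebra

open Multiplier in
theorem lemma2p2 {A : Type*} [NonUnitalRing A] [Module ℂ A] [SMulCommClass ℂ A A]
    [IsScalarTower ℂ A A] (H : RegularMultiplierHopfAlgebra A) (R : Multiplier (A ⊗[ℂ] A))
    (hR : ∀ a : A, R * tmul (of a) 1 ∈ LinearMap.range (ofTensor (A := A)))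
    (hR' : ∀ a : A, tmul (of a) 1 * R ∈ LinearMap.range (ofTensor (A := A)))
    (hcop : ∀ a : A, R * H.Δ a = H.Δcop a * R) :
    ∃ u : Multiplier A,
      (∀ a : A, left u a = H.drinfeldMap R hR a) ∧
      (∀ a : A, u * of a = of (H.antipode (H.antipode a)) * u) ∧
      (IsUnit R → ∃ U V : (Multiplier A)ˣ, (U : Multiplier A) = u ∧
        (V : Multiplier A) = H.antipodeM u ∧
        ∀ a : A, of (H.antipode (H.antipode a)) = U * of a * ↑U⁻¹ ∧
          of (H.antipode (H.antipode a)) = ↑V⁻¹ * of a * V) := by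
  refine ⟨H.drinfeldElement R hR hcop, H.left_drinfeldElement R hR hcop,
    H.drinfeldElement_mul_of R hR hcop, fun hu => ?_⟩
  have hl : Function.Bijective (left (H.drinfeldElement R hR hcop)) :=
    H.drinfeldMap_bijective R hR hcop hu
  have hr : Function.Bijective (right (H.drinfeldElement R hR hcop)) :=
    hl.comp (H.antipodeEquiv.symm.bijective.comp H.antipodeEquiv.symm.bijective)
  obtain ⟨U, hU⟩ := isUnit_of_bijective hl hr
  obtain ⟨V, hV⟩ := H.isUnit_antipodeM hl hr
  refine ⟨U, V, hU, hV, fun a => ⟨?_, ?_⟩⟩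
  · rw [Units.eq_mul_inv_iff_mul_eq, hU, H.drinfeldElement_mul_of]
  -- With a = S(b), applying S to ub = S²(b)u gives aS(u) = S(u)S²(a).
  · obtain ⟨b, rfl⟩ := H.antipode_bijective.2 a
    rw [mul_assoc, Units.eq_inv_mul_iff_mul_eq, hV]
    exact H.antipodeM_mul_of _ _ _ (H.drinfeldElement_mul_of R hR hcop b)
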